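/- Let $k$ be a field. A *rational pointed fan* $\Sigma$ in $\mathbb{R}^d$ is a nonempty collection of convex cones, each generated by finitely many rational vectors and having $\{0\}$ as a face, such that every face of a cone of $\Sigma$ belongs to $\Sigma$ and any two cones of $\Sigma$ intersect in a common face; here a face of a cone $C$ is a set $\{x\in C : l(x)=0\}$ with $l$ a linear form that is nonnegative on $C$. A *monoidal complex* $\mathcal{M}$ supported on $\Sigma$ is a family of finitely generated submonoids $M_C\subseteq C\cap\mathbb{Z}^d$ $(C\in\Sigma)$ such that $M_C$ generates the cone $C$, and $M_D=M_C\cap D$ whenever $C,D\in\Sigma$ and $D\subseteq C$. Put $|\mathcal{M}|=\bigcup_{C\in\Sigma}M_C$. The *toric face ring* $k[\mathcal{M}]$ is the $\mathbb{Z}^d$-graded $k$-algebra with $k$-basis $\{t^a : a\in|\mathcal{M}|\}$, where $t^a$ has degree $a$, and with $t^a t^b=t^{a+b}$ if $a,b\in M_C$ for some $C\in\Sigma$ and $t^at^b=0$ otherwise. A *subfan* $\Gamma$ of $\Sigma$ is a rational pointed fan all of whose cones belong to $\Sigma$; $\mathcal{M}_\Gamma=(M_D)_{D\in\Gamma}$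 is the induced monoidal complex on it. The subfan $\Gamma$ is *restricted* if, whenever finitely many points of $\bigcup_{D\in\Gamma}D$ lie in a common cone of $\Sigma$, they lie in a common cone of $\Gamma$. **Proposition 4.5.** Let $\mathcal{M}$ be a monoidal complex supported on a rational pointed fan $\Sigma$ in $\mathbb{R}^d$, and let $A$ be a commutative $\mathbb{Z}^d$-graded ring. Then $A$ is a $\mathbb{Z}^d$-graded algebra retract of $k[\mathcal{M}]$, that is, there are graded ring homomorphisms $\theta\colon A\to k[\mathcal{M}]$ and $\varphi\colon k[\mathcal{M}]\to A$ with $\varphi\circ\theta=\mathrm{id}_A$, if and only if there is a restricted subfan $\Gamma$ of $\Sigma$ such that $A\cong k[\mathcal{M}_\Gamma]$ as $\mathbb{Z}^d$-graded rings. If $A$ is a commutative $\mathbb{Z}^d$-graded $k$-algebra, the same equivalence holds with $\theta$, $\varphi$ and the isomorphism required to be homomorphisms of graded $k$-algebras. -/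

import Mathlib

/-! ### Rational pointed fans -/

/-- The inclusion `ℤ^d ⊆ ℝ^d`. -/
def latticePoint {d : ℕ} (a : Fin d → ℤ) : Fin d → ℝ := fun i => (a i : ℝ)

/-- `F` is a face of the cone `C` in `ℝ^d`: it is the intersection of `C` with a hyperplane `l = 0`
such that `C` lies in the half-space `l ≥ 0`. As usual `l = 0` is allowed, so that `C` is a face of
itself. (A hyperplane that meets a cone and has the cone on one side passes through the origin.) -/
def IsConeFace {d : ℕ} (F C : PointedCone ℝ (Fin d → ℝ)) : Prop :=
  ∃ l : (Fin d → ℝ) →ₗ[ℝ] ℝ, (∀ x ∈ C, 0 ≤ l x) ∧ ∀ x, x ∈ F ↔ x ∈ C ∧ l x = 0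

/-- A cone generated by finitely many rational vectors. -/
def IsRationalCone {d : ℕ} (C : PointedCone ℝ (Fin d → ℝ)) : Prop :=
  ∃ s : Set (Fin d → ℚ), s.Finite ∧
    C = PointedCone.hull ℝ ((fun (v : Fin d → ℚ) (i : Fin d) => (v i : ℝ)) '' s)

/-- A rational pointed fan in `ℝ^d`. (All cones contain the origin, hence no two of them have
empty intersection. Mathlib's `PointedCone` only means a convex cone containing `0`; that the cones
are pointed in the sense of convex geometry is the field `pointed`.) -/
structure RationalPointedFan (d : ℕ) where
  /-- the cones of the fan -/
  cones : Set (PointedCone ℝ (Fin d → ℝ))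
  nonempty : cones.Nonempty
  rational : ∀ C ∈ cones, IsRationalCone C
  pointed : ∀ C ∈ cones, IsConeFace ⊥ C
  face_mem : ∀ C ∈ cones, ∀ C', IsConeFace C' C → C' ∈ cones
  inter_face : ∀ C ∈ cones, ∀ D ∈ cones, IsConeFace (C ⊓ D) C ∧ IsConeFace (C ⊓ D) D

namespace RationalPointedFan

/-- The support `|Γ|` of a fan: the union of its cones. -/
def support {d : ℕ} (Γ : RationalPointedFan d) : Set (Fin d → ℝ) :=
  {x | ∃ D ∈ Γ.cones, x ∈ D}

/-- `Γ` is a subfan of `F`: a fan all of whose cones belong to `F`. -/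
def IsSubfan {d : ℕ} (Γ F : RationalPointedFan d) : Prop := Γ.cones ⊆ F.cones

/-- `Γ` is a restricted subfan of `F`: a subfan such that any finitely many points of `|Γ|` that lie
in a common cone of `F` lie in a common cone of `Γ`. -/
structure IsRestrictedSubfan {d : ℕ} (Γ F : RationalPointedFan d) : Prop where
  isSubfan : Γ.IsSubfan F
  exists_cone : ∀ s : Finset (Fin d → ℝ), (∀ x ∈ s, x ∈ Γ.support) →
    (∃ C ∈ F.cones, ∀ x ∈ s, x ∈ C) → ∃ D ∈ Γ.cones, ∀ x ∈ s, x ∈ D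

end RationalPointedFan

/-! ### Monoidal complexes -/

/-- A monoidal complex supported on the fan `F`: an affine monoid `M_C ⊆ C ∩ ℤ^d` generating the
cone `C`, for every cone `C` of `F`, with `M_D = M_C ∩ D` whenever `D ⊆ C`. -/
structure MonoidalComplex {d : ℕ} (F : RationalPointedFan d) where
  /-- the affine monoid `M_C` -/
  monoid : {C : PointedCone ℝ (Fin d → ℝ) // C ∈ F.cones} → AddSubmonoid (Fin d → ℤ)
  fg : ∀ C, (monoid C).FG
  mem_cone : ∀ C, ∀ a ∈ monoid C, latticePoint a ∈ C.1
  generates : ∀ C, PointedCone.hull ℝ (latticePoint '' (monoid C : Set (Fin d → ℤ))) = C.1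
  compatible : ∀ C D, D.1 ≤ C.1 → ∀ a, a ∈ monoid D ↔ a ∈ monoid C ∧ latticePoint a ∈ D.1

namespace MonoidalComplex

variable {d : ℕ} {F Γ : RationalPointedFan d}

/-- The induced monoidal subcomplex `M_Γ` on a subfan `Γ`. -/
def restrict (M : MonoidalComplex F) (h : Γ.IsSubfan F) : MonoidalComplex Γ where
  monoid C := M.monoid ⟨C.1, h C.2⟩
  fg _ := M.fg _
  mem_cone _ := M.mem_cone _
  generates _ := M.generates _
  compatible C D hDC := M.compatible ⟨C.1, h C.2⟩ ⟨D.1, h D.2⟩ hDC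

/-- `|M|`, the union of the monoids `M_C`. -/
def support (M : MonoidalComplex F) : Set (Fin d → ℤ) := {a | ∃ C, a ∈ M.monoid C}

/-- `a` and `b` are contained in `M_C` for some cone `C` of the fan. -/
def Compat (M : MonoidalComplex F) (a b : Fin d → ℤ) : Prop :=
  ∃ C, a ∈ M.monoid C ∧ b ∈ M.monoid C

theorem Compat.add_mem {M : MonoidalComplex F} {a b : Fin d → ℤ} (h : M.Compat a b) :
    a + b ∈ M.support :=
  let ⟨C, ha, hb⟩ := h
  ⟨C, AddSubmonoid.add_mem _ ha hb⟩

theorem Compat.symm {M : MonoidalComplex F} {a b : Fin d → ℤ} (h : M.Compat a b) :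
    M.Compat b a :=
  let ⟨C, ha, hb⟩ := h
  ⟨C, hb, ha⟩

theorem zero_mem_support (M : MonoidalComplex F) : 0 ∈ M.support :=
  ⟨⟨F.nonempty.some, F.nonempty.some_mem⟩, zero_mem _⟩

theorem mem_monoid_of_mem_cone (M : MonoidalComplex F) {a : Fin d → ℤ}
    {C D : {C : PointedCone ℝ (Fin d → ℝ) // C ∈ F.cones}}
    (ha : a ∈ M.monoid C) (haD : latticePoint a ∈ D.1) : a ∈ M.monoid D := by
  have hE := F.face_mem C.1 C.2 _ (F.inter_face C.1 C.2 D.1 D.2).1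
  have h1 := (M.compatible C ⟨_, hE⟩ inf_le_left a).2 ⟨ha, M.mem_cone C a ha, haD⟩
  exact ((M.compatible D ⟨_, hE⟩ inf_le_right a).1 h1).1

/-- If `a, b ∈ M_C` and `a + b` lies in a cone `D` of the fan, then `a, b ∈ M_D`. -/
theorem mem_of_add_mem (M : MonoidalComplex F) {a b : Fin d → ℤ}
    {C D : {C : PointedCone ℝ (Fin d → ℝ) // C ∈ F.cones}}
    (ha : a ∈ M.monoid C) (hb : b ∈ M.monoid C) (hab : latticePoint (a + b) ∈ D.1) :
    a ∈ M.monoid D ∧ b ∈ M.monoid D := by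
  obtain ⟨l, hl, hF⟩ := (F.inter_face C.1 C.2 D.1 D.2).1
  have hadd : latticePoint (a + b) = latticePoint a + latticePoint b := by
    ext i; simp [latticePoint]
  have h0 := ((hF _).1 ⟨M.mem_cone C _ (add_mem ha hb), hab⟩).2
  rw [hadd, map_add] at h0
  have h1 := hl _ (M.mem_cone C a ha)
  have h2 := hl _ (M.mem_cone C b hb)
  have ha' := ((hF (latticePoint a)).2 ⟨M.mem_cone C a ha, by linarith⟩).2
  have hb' := ((hF (latticePoint b)).2 ⟨M.mem_cone C b hb, by linarith⟩).2
  exact ⟨M.mem_monoid_of_mem_cone ha ha', M.mem_monoid_of_mem_cone hb hb'⟩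

theorem compat_assoc (M : MonoidalComplex F) (a b c : Fin d → ℤ) :
    (M.Compat a b ∧ M.Compat (a + b) c) ↔ (M.Compat b c ∧ M.Compat a (b + c)) := by
  constructor
  · rintro ⟨⟨C, ha, hb⟩, ⟨D, hab, hc⟩⟩
    obtain ⟨ha', hb'⟩ := M.mem_of_add_mem ha hb (M.mem_cone D _ hab)
    exact ⟨⟨D, hb', hc⟩, ⟨D, ha', add_mem hb' hc⟩⟩
  · rintro ⟨⟨C, hb, hc⟩, ⟨D, ha, hbc⟩⟩
    obtain ⟨hb', hc'⟩ := M.mem_of_add_mem hb hc (M.mem_cone D _ hbc)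
    exact ⟨⟨D, ha, hb'⟩, ⟨D, add_mem ha hb', hc'⟩⟩

end MonoidalComplex

/-! ### Toric face rings -/

/-- The toric face ring `k[M]`: as a `k`-vector space it has the basis `t^a`, `a ∈ |M|`. -/
def ToricFaceRing (k : Type*) [Field k] {d : ℕ} {F : RationalPointedFan d}
    (M : MonoidalComplex F) : Type _ :=
  M.support →₀ k

namespace ToricFaceRing

variable {k : Type*} [Field k] {d : ℕ} {F : RationalPointedFan d} {M : MonoidalComplex F}

noncomputable instance : AddCommGroup (ToricFaceRing k M) :=
  inferInstanceAs (AddCommGroup (M.support →₀ k))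

noncomputable instance : Module k (ToricFaceRing k M) :=
  inferInstanceAs (Module k (M.support →₀ k))

/-- The basis `(t^a)_{a ∈ |M|}` of `k[M]`. -/
noncomputable def basis (k : Type*) [Field k] {d : ℕ} {F : RationalPointedFan d}
    (M : MonoidalComplex F) : Module.Basis M.support k (ToricFaceRing k M) :=
  Module.Basis.ofRepr (LinearEquiv.refl k (M.support →₀ k))

open Classical in
/-- The product `t^a * t^b`: it is `t^(a+b)` if `a` and `b` are contained in a common `M_C`, and `0`
otherwise. -/
noncomputable def basisMul (k : Type*) [Field k] {d : ℕ} {F : RationalPointedFan d}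
    (M : MonoidalComplex F) (a b : M.support) : ToricFaceRing k M :=
  if h : M.Compat a.1 b.1 then basis k M ⟨a.1 + b.1, h.add_mem⟩ else 0

/-- The multiplication of `k[M]`, as the bilinear extension of `basisMul`. -/
noncomputable def mulLin (k : Type*) [Field k] {d : ℕ} {F : RationalPointedFan d}
    (M : MonoidalComplex F) :
    ToricFaceRing k M →ₗ[k] ToricFaceRing k M →ₗ[k] ToricFaceRing k M :=
  (basis k M).constr k fun a => (basis k M).constr k fun b => basisMul k M a b

noncomputable instance : Mul (ToricFaceRing k M) := ⟨fun x y => mulLin k M x y⟩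

noncomputable instance : One (ToricFaceRing k M) := ⟨basis k M ⟨0, M.zero_mem_support⟩⟩

theorem mul_def (x y : ToricFaceRing k M) : x * y = mulLin k M x y := rfl

theorem one_def : (1 : ToricFaceRing k M) = basis k M ⟨0, M.zero_mem_support⟩ := rfl

theorem basis_mul_basis (a b : M.support) : basis k M a * basis k M b = basisMul k M a b := by
  simp [mul_def, mulLin]

theorem mulLin_comm : mulLin k M = (mulLin k M).flip := by
  refine (basis k M).ext fun a => (basis k M).ext fun b => ?_
  simp only [LinearMap.flip_apply, ← mul_def, basis_mul_basis, basisMul]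
  by_cases h : M.Compat a.1 b.1
  · simp [h, h.symm, add_comm]
  · have h' : ¬ M.Compat b.1 a.1 := fun h' => h h'.symm
    simp [h, h']

theorem mulLin_one : mulLin k M 1 = LinearMap.id := by
  refine (basis k M).ext fun b => ?_
  have h : M.Compat 0 b.1 := let ⟨C, hC⟩ := b.2; ⟨C, zero_mem _, hC⟩
  simp [← mul_def, one_def, basis_mul_basis, basisMul, h]

theorem basis_mul_assoc (a b c : M.support) :
    basis k M a * basis k M b * basis k M c = basis k M a * (basis k M b * basis k M c) := by
  have key := M.compat_assoc a.1 b.1 c.1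
  simp only [basis_mul_basis, basisMul]
  by_cases h1 : M.Compat a.1 b.1 <;> by_cases h2 : M.Compat b.1 c.1 <;>
    simp only [h1, h2, dite_true, dite_false, basis_mul_basis, basisMul, true_and, false_and,
      iff_false, false_iff] at key ⊢
  · by_cases h : M.Compat a.1 (b.1 + c.1)
    · simp [h, key.2 h, add_assoc]
    · have h' : ¬ M.Compat (a.1 + b.1) c.1 := fun h' => h (key.1 h')
      simp [h, h']
  · simp [key, mul_def]
  · simp [key, mul_def]
  · simp [mul_def]

theorem mulLin_assoc (x y z : ToricFaceRing k M) :
    mulLin k M (mulLin k M x y) z = mulLin k M x (mulLin k M y z) := by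
  have h1 : ∀ (a b : M.support) (z : ToricFaceRing k M),
      mulLin k M (mulLin k M (basis k M a) (basis k M b)) z =
        mulLin k M (basis k M a) (mulLin k M (basis k M b) z) := fun a b =>
    LinearMap.congr_fun (f := mulLin k M (mulLin k M (basis k M a) (basis k M b)))
      (g := mulLin k M (basis k M a) ∘ₗ mulLin k M (basis k M b))
      ((basis k M).ext fun c => basis_mul_assoc a b c)
  have h2 : ∀ (a : M.support) (y z : ToricFaceRing k M),
      mulLin k M (mulLin k M (basis k M a) y) z =
        mulLin k M (basis k M a) (mulLin k M y z) := fun a y z =>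
    LinearMap.congr_fun (f := (mulLin k M).flip z ∘ₗ mulLin k M (basis k M a))
      (g := mulLin k M (basis k M a) ∘ₗ (mulLin k M).flip z)
      ((basis k M).ext fun b => h1 a b z) y
  exact LinearMap.congr_fun (f := (mulLin k M).flip z ∘ₗ (mulLin k M).flip y)
      (g := (mulLin k M).flip (mulLin k M y z))
      ((basis k M).ext fun a => h2 a y z) x

theorem mulLin_comm_apply (x y : ToricFaceRing k M) : mulLin k M x y = mulLin k M y x :=
  LinearMap.congr_fun₂ (mulLin_comm (k := k) (M := M)) x y

noncomputable instance : CommRing (ToricFaceRing k M) where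
  __ := (inferInstance : AddCommGroup (ToricFaceRing k M))
  left_distrib x y z := map_add (mulLin k M x) y z
  right_distrib x y z := (mulLin k M).map_add₂ x y z
  zero_mul x := (mulLin k M).map_zero₂ x
  mul_zero x := map_zero (mulLin k M x)
  mul_assoc := mulLin_assoc
  one_mul x := LinearMap.congr_fun (mulLin_one (k := k) (M := M)) x
  mul_one x := (mulLin_comm_apply x 1).trans
    (LinearMap.congr_fun (mulLin_one (k := k) (M := M)) x)
  mul_comm := mulLin_comm_apply

noncomputable instance : Algebra k (ToricFaceRing k M) :=
  Algebra.ofModule (fun r x y => (mulLin k M).map_smul₂ r x y)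
    (fun r x y => map_smul (mulLin k M x) r y)

/-- The `ℤ^d`-grading of `k[M]`: the component of degree `n` is spanned by `t^n` if `n ∈ |M|` and
it is `0` otherwise. -/
noncomputable def grading (k : Type*) [Field k] {d : ℕ} {F : RationalPointedFan d}
    (M : MonoidalComplex F) (n : Fin d → ℤ) : Submodule k (ToricFaceRing k M) :=
  Submodule.span k {x | ∃ a : M.support, a.1 = n ∧ x = basis k M a}

theorem basis_mem_grading (a : M.support) : basis k M a ∈ grading k M a.1 :=
  Submodule.subset_span ⟨a, rfl, rfl⟩

theorem basisMul_mem_grading (a b : M.support) : basisMul k M a b ∈ grading k M (a.1 + b.1) := by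
  unfold basisMul
  split_ifs with h
  · exact basis_mem_grading (k := k) (M := M) ⟨a.1 + b.1, h.add_mem⟩
  · exact zero_mem _

instance : SetLike.GradedMonoid (grading k M) where
  one_mem := basis_mem_grading (k := k) (M := M) ⟨0, M.zero_mem_support⟩
  mul_mem m n x y hx hy := by
    have h := Submodule.mul_mem_mul hx hy
    rw [grading, grading, Submodule.span_mul_span] at h
    refine Submodule.span_le.2 ?_ h
    rintro _ ⟨_, ⟨a, rfl, rfl⟩, _, ⟨b, rfl, rfl⟩, rfl⟩
    simp only [SetLike.mem_coe, basis_mul_basis]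
    exact basisMul_mem_grading a b

/-- The decomposition of an element of `k[M]` into homogeneous components. -/
noncomputable def decomposeLin (k : Type*) [Field k] {d : ℕ} {F : RationalPointedFan d}
    (M : MonoidalComplex F) :
    ToricFaceRing k M →ₗ[k] DirectSum (Fin d → ℤ) fun n => grading k M n :=
  (basis k M).constr k fun a =>
    DirectSum.lof k (Fin d → ℤ) (fun n => grading k M n) a.1 ⟨basis k M a, basis_mem_grading a⟩

noncomputable instance : GradedAlgebra (grading k M) where
  toDecomposition := DirectSum.Decomposition.ofLinearMap _ (decomposeLin k M)
    ((basis k M).ext fun a => by simp [decomposeLin])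
    (by
      refine DirectSum.linearMap_ext _ fun n => ?_
      ext ⟨x, hx⟩ : 1
      simp only [LinearMap.comp_apply, DirectSum.coeLinearMap_lof, LinearMap.id_apply]
      induction hx using Submodule.span_induction with
      | mem x h =>
        obtain ⟨a, rfl, rfl⟩ := h
        simp [decomposeLin]
      | zero =>
        rw [map_zero]
        exact (map_zero (DirectSum.lof k (Fin d → ℤ) (fun n => grading k M n) n)).symm
      | add x y hx hy h1 h2 =>
        rw [map_add, h1, h2, ← map_add]; rfl
      | smul r x hx h =>
        rw [map_smul, h, ← map_smul]; rfl)

end ToricFaceRing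

/-! ### Graded algebra retracts -/

section GradedRetracts

variable {ι A B : Type*} [DecidableEq ι] [AddMonoid ι] [CommRing A] [CommRing B]

/-- The graded ring `A` is a graded algebra retract of the graded ring `B`: there are graded ring
homomorphisms `θ : A → B` and `φ : B → A` with `φ ∘ θ = id` (in particular, `θ` is injective). -/
def IsGradedRetract {σ τ : Type*} [SetLike σ A] [SetLike τ B] (𝒜 : ι → σ) (ℬ : ι → τ) : Prop :=
  ∃ (θ : 𝒜 →+*ᵍ ℬ) (φ : ℬ →+*ᵍ 𝒜), ∀ x : A, φ (θ x) = x

/-- `A ≅ B` as graded rings. -/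
def IsGradedIso {σ τ : Type*} [SetLike σ A] [SetLike τ B] (𝒜 : ι → σ) (ℬ : ι → τ) : Prop :=
  ∃ e : A ≃+* B, ∀ n x, e x ∈ ℬ n ↔ x ∈ 𝒜 n

/-- The version of `IsGradedRetract` for graded `k`-algebras: all maps are `k`-linear. -/
def IsGradedRetractOver (k : Type*) [Field k] [Algebra k A] [Algebra k B]
    (𝒜 : ι → Submodule k A) (ℬ : ι → Submodule k B) [GradedAlgebra 𝒜] [GradedAlgebra ℬ] : Prop :=
  ∃ (θ : 𝒜 →ₐᵍ[k] ℬ) (φ : ℬ →ₐᵍ[k] 𝒜), ∀ x : A, φ (θ x) = x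

/-- `A ≅ B` as graded `k`-algebras. -/
def IsGradedIsoOver (k : Type*) [Field k] [Algebra k A] [Algebra k B]
    (𝒜 : ι → Submodule k A) (ℬ : ι → Submodule k B) : Prop :=
  ∃ e : A ≃ₐ[k] B, ∀ n x, e x ∈ ℬ n ↔ x ∈ 𝒜 n

end GradedRetracts

/-! ### Faces of affine monoids -/

/-! A retract gives an idempotent graded endomorphism `ε = θ ∘ φ` of `k[M]`. Its degree-zero part is
an idempotent endomorphism of the field `k`, hence the identity, so `ε` is `k`-linear even if `θ`
and `φ` are only ring homomorphisms (`idempotent_commutes`). All components have dimension at most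
one, so `ε` sends each `t^a` to `0` or to itself. Let `S` be the set of surviving exponents. Inside
one `M_C` one has `t^a t^b = t^(a+b)`, so `a + b` survives iff both `a` and `b` do: `S ∩ M_C` is a
submonoid containing the summands of its elements.

By Farkas' lemma such a submonoid is cut out by a supporting hyperplane
(`exists_linearForm_of_summand_closed`), so it is `M_D` for a face `D` of `C`. The cones whose
monoids lie in `S` form a restricted subfan `Γ`, and `ε` is the projection to `k[M_Γ]` followed by
the inclusion. Hence `A`, being isomorphic to the image of `ε`, is `k[M_Γ]`.

Conversely, the projection and, thanks to restrictedness, the inclusion are multiplicative, and they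
exhibit `k[M_Γ]` as a retract. -/

/-- **Farkas' lemma** for finitely generated cones over a linearly ordered field. -/
theorem PointedCone.exists_separating_of_notMem_hull {K V : Type*} [Field K] [LinearOrder K]
    [IsStrictOrderedRing K] [AddCommGroup V] [Module K V] {s : Set V} (hs : s.Finite) {b : V}
    (hb : b ∉ PointedCone.hull K s) :
    ∃ l : V →ₗ[K] K, (∀ x ∈ s, 0 ≤ l x) ∧ l b < 0 := by
  -- The endomorphism `p` is there for the induction: the hypothesis must apply to generators
  -- projected along the new one.
  suffices H : ∀ (p : V →ₗ[K] V) (b : V), b ∉ PointedCone.hull K (p '' s) →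
      ∃ l : V →ₗ[K] K, (∀ x ∈ s, 0 ≤ l (p x)) ∧ l b < 0 by
    simpa using H LinearMap.id b (by simpa using hb)
  clear hb b
  induction s, hs using Set.Finite.induction_on with
  | empty =>
    intro p b hb
    have hb0 : b ≠ 0 := by rintro rfl; exact hb (zero_mem _)
    obtain ⟨l, hl⟩ := not_forall.1 (mt (Module.forall_dual_apply_eq_zero_iff K b).1 hb0)
    exact ⟨-(l b • l), by simp, by simpa using mul_self_pos.2 hl⟩
  | @insert a s _ _ ih =>
    intro p b hb
    obtain ⟨l, hl, hlb⟩ := ih p b fun h => hb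
      (Submodule.span_mono (Set.image_mono (Set.subset_insert a s)) h)
    by_cases hla : 0 ≤ l (p a)
    · exact ⟨l, by simpa [hla] using hl, hlb⟩
    push Not at hla
    -- `q` is the projection onto the kernel of `l` along `p a`.
    let q : V →ₗ[K] V := LinearMap.id - (l.smulRight ((l (p a))⁻¹ • p a))
    have hq : ∀ x, q x = x - (l x * (l (p a))⁻¹) • p a := fun x => by simp [q, smul_smul]
    have hqa : q (p a) = 0 := by simp [hq, hla.ne]
    by_cases hqb : q b ∈ PointedCone.hull K ((q ∘ₗ p) '' s)
    · exfalso
      -- Undoing `q` adds only nonnegative multiples of `p a`, since `l` is nonnegative on the old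
      -- generators and negative on `p a`.
      have hmem : ∀ y ∈ PointedCone.hull K ((q ∘ₗ p) '' s),
          ∃ z ∈ PointedCone.hull K (p '' insert a s), ∃ r : K, 0 ≤ r ∧ y = z + r • p a := by
        intro y hy
        induction hy using Submodule.span_induction with
        | mem y hy =>
          obtain ⟨x, hx, rfl⟩ := hy
          refine ⟨p x, Submodule.subset_span ⟨x, Or.inr hx, rfl⟩, -(l (p x) * (l (p a))⁻¹), ?_, ?_⟩
          · exact neg_nonneg.2 (mul_nonpos_of_nonneg_of_nonpos (hl x hx) (inv_nonpos.2 hla.le))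
          · simp [hq, sub_eq_add_neg]
        | zero => exact ⟨0, zero_mem _, 0, le_rfl, by simp⟩
        | add y y' _ _ h h' =>
          obtain ⟨z, hz, r, hr, rfl⟩ := h
          obtain ⟨z', hz', r', hr', rfl⟩ := h'
          exact ⟨z + z', add_mem hz hz', r + r', add_nonneg hr hr', by rw [add_smul]; abel⟩
        | smul c y _ h =>
          obtain ⟨z, hz, r, hr, rfl⟩ := h
          refine ⟨c • z, Submodule.smul_mem _ c hz, c * r, mul_nonneg c.2 hr, ?_⟩
          rw [smul_add, mul_smul]; rfl
      obtain ⟨z, hz, r, hr, hzr⟩ := hmem _ hqb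
      -- As `l b` and `l (p a)` are both negative, the total coefficient of `p a` is nonnegative,
      -- which puts `b` in the cone.
      have hb' : b = z + (r + l b * (l (p a))⁻¹) • p a := by
        rw [add_smul, ← add_assoc, ← hzr, hq]; abel
      refine hb (hb' ▸ add_mem hz ?_)
      have hc : 0 ≤ r + l b * (l (p a))⁻¹ :=
        add_nonneg hr (mul_nonneg_of_nonpos_of_nonpos hlb.le (inv_nonpos.2 hla.le))
      exact Submodule.smul_mem _ (⟨_, hc⟩ : {c : K // 0 ≤ c})
        (Submodule.subset_span ⟨a, Or.inl rfl, rfl⟩)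
    -- Composing with `q` makes the new form vanish on `p a`.
    · obtain ⟨l', hl', hlb'⟩ := ih (q ∘ₗ p) (q b) hqb
      exact ⟨l' ∘ₗ q, by simpa [hqa] using hl', hlb'⟩


/-! ### Supporting linear forms of summand-closed submonoids -/

section FaceFunctional

variable {d : ℕ}

/-- The inclusion `ℤ^d ⊆ ℚ^d` as an additive homomorphism. -/
def rationalPoint (d : ℕ) : (Fin d → ℤ) →+ (Fin d → ℚ) where
  toFun a i := (a i : ℚ)
  map_zero' := by ext; simp
  map_add' a b := by ext; simp

theorem rationalPoint_injective (d : ℕ) : Function.Injective (rationalPoint d) := fun a b h => by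
  ext i
  simpa [rationalPoint] using congrFun h i

theorem latticePoint_add (a b : Fin d → ℤ) :
    latticePoint (a + b) = latticePoint a + latticePoint b := by
  ext; simp [latticePoint]

theorem latticePoint_zero : latticePoint (0 : Fin d → ℤ) = 0 := by
  ext; simp [latticePoint]

/-- Every rational linear form extends to a real one. -/
theorem exists_real_extension (l : (Fin d → ℚ) →ₗ[ℚ] ℚ) :
    ∃ L : (Fin d → ℝ) →ₗ[ℝ] ℝ, ∀ a, L (latticePoint a) = (l (rationalPoint d a) : ℝ) := by
  refine ⟨∑ i, ((l (Pi.single i 1) : ℚ) : ℝ) • LinearMap.proj i, fun a => ?_⟩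
  rw [LinearMap.pi_apply_eq_sum_univ l (rationalPoint d a)]
  have h : ∀ i : Fin d, (fun j => if i = j then (1 : ℚ) else 0) = Pi.single i 1 := fun i => by
    ext j; simp [Pi.single_apply, eq_comm]
  simp [h, latticePoint, rationalPoint, mul_comm]

/-- Multiples of elements of the rational cone spanned by an additive monoid and one opposite of a
lattice point are lattice points of the evident shape. -/
theorem exists_nsmul_eq_of_mem_hull {N : AddSubmonoid (Fin d → ℤ)} {G : Set (Fin d → ℤ)}
    (hG : G ⊆ N) {s : Fin d → ℤ} {x : Fin d → ℚ}
    (hx : x ∈ PointedCone.hull ℚ (insert (-rationalPoint d s) (rationalPoint d '' G))) :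
    ∃ n : ℕ, 0 < n ∧ ∃ m : ℕ, ∃ a ∈ N,
      n • x = rationalPoint d a - m • rationalPoint d s := by
  induction hx using Submodule.span_induction with
  | mem x hx =>
    obtain rfl | ⟨g, hg, rfl⟩ := hx
    · exact ⟨1, one_pos, 1, 0, zero_mem _, by simp⟩
    · exact ⟨1, one_pos, 0, g, hG hg, by simp⟩
  | zero => exact ⟨1, one_pos, 0, 0, zero_mem _, by simp⟩
  | add x y _ _ hx hy =>
    obtain ⟨n, hn, m, a, ha, hx⟩ := hx
    obtain ⟨n', hn', m', a', ha', hy⟩ := hy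
    refine ⟨n * n', Nat.mul_pos hn hn', n' * m + n * m', n' • a + n • a',
      add_mem (nsmul_mem ha _) (nsmul_mem ha' _), ?_⟩
    rw [nsmul_add, mul_comm n n', mul_nsmul' x, mul_comm n' n, mul_nsmul' y, hx, hy]
    simp only [map_add, map_nsmul, nsmul_sub, add_nsmul, mul_nsmul']
    abel
  | smul q x _ hx =>
    obtain ⟨n, hn, m, a, ha, hx⟩ := hx
    obtain ⟨q, hq⟩ := q
    -- Clearing the denominator of the scalar is possible because the cone is taken over `ℚ`; its
    -- numerator is a natural number as the scalar is nonnegative.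
    refine ⟨q.den * n, Nat.mul_pos q.den_pos hn, q.num.toNat * m, q.num.toNat • a,
      nsmul_mem ha _, ?_⟩
    have hnum : ((q.num.toNat : ℕ) : ℚ) = q.num := by
      exact_mod_cast Int.toNat_of_nonneg (Rat.num_nonneg.2 hq)
    have hden : (q.den : ℚ) * q = q.num := by rw [mul_comm]; exact Rat.mul_den_eq_num q
    have h1 : (q.den * n) • (q • x) = q.num.toNat • (n • x) := by
      simp only [← Nat.cast_smul_eq_nsmul ℚ, smul_smul, Nat.cast_mul, hnum, ← hden]
      congr 1; ring
    change (q.den * n) • (q • x) = _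
    rw [h1, hx, nsmul_sub, map_nsmul, mul_nsmul']

/-- A submonoid of an affine monoid that contains the summands of its elements is cut out by a
linear form that is nonnegative on the monoid. -/
theorem exists_linearForm_of_summand_closed {N T : AddSubmonoid (Fin d → ℤ)} (hN : N.FG)
    (hT : ∀ a ∈ N, ∀ b ∈ N, a + b ∈ T → a ∈ T) :
    ∃ L : (Fin d → ℝ) →ₗ[ℝ] ℝ, ∀ a ∈ N,
      0 ≤ L (latticePoint a) ∧ (L (latticePoint a) = 0 ↔ a ∈ T) := by
  classical
  obtain ⟨G, hG⟩ := hN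
  have hGN : (G : Set (Fin d → ℤ)) ⊆ N := hG ▸ AddSubmonoid.subset_closure
  -- Adjoining `-s` to the generators makes a separating form vanish on every generator in `T`: it
  -- is nonnegative on each summand of `s` and on `-s`.
  set s : Fin d → ℤ := ∑ g ∈ G with g ∈ T, g with hs
  have hsT : s ∈ T := sum_mem fun g hg => (Finset.mem_filter.1 hg).2
  have key : ∀ g : Fin d → ℤ, ∃ l : (Fin d → ℚ) →ₗ[ℚ] ℚ, (∀ x ∈ G, 0 ≤ l (rationalPoint d x)) ∧
      (∀ x ∈ G, x ∈ T → l (rationalPoint d x) = 0) ∧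
      (g ∈ G → g ∉ T → 0 < l (rationalPoint d g)) := by
    intro g
    by_cases hg : g ∈ G ∧ g ∉ T
    swap
    · exact ⟨0, by simp, by simp, fun h h' => (hg ⟨h, h'⟩).elim⟩
    obtain ⟨hgG, hgT⟩ := hg
    obtain ⟨l, hl, hlg⟩ := PointedCone.exists_separating_of_notMem_hull (K := ℚ)
      (s := insert (-rationalPoint d s) (rationalPoint d '' (G : Set (Fin d → ℤ))))
      -- If `-g` were in the cone, some positive multiple of `g` plus an element of `N` would be a
      -- multiple of `s`, hence in `T`; splitting off one copy of `g` would then put `g` in `T`.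
      (b := -rationalPoint d g) ((G.finite_toSet.image _).insert _) (by
        intro hmem
        obtain ⟨n, hn, m, a, ha, h⟩ := exists_nsmul_eq_of_mem_hull hGN hmem
        have h' : n • g + a = m • s := rationalPoint_injective d (by
          rw [smul_neg, neg_eq_iff_eq_neg, neg_sub] at h
          rw [map_add, map_nsmul, map_nsmul, h, sub_add_cancel])
        obtain ⟨n, rfl⟩ := Nat.exists_eq_succ_of_ne_zero hn.ne'
        refine hgT (hT g (hGN hgG) (n • g + a) (add_mem (nsmul_mem (hGN hgG) _) ha) ?_)
        rw [← add_assoc, ← succ_nsmul', h']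
        exact nsmul_mem hsT _)
    have hlG : ∀ x ∈ G, 0 ≤ l (rationalPoint d x) := fun x hx => hl _ (Or.inr ⟨x, hx, rfl⟩)
    refine ⟨l, hlG, fun x hx hxT => ?_, fun _ _ => by simpa using hlg⟩
    have h1 := hl _ (Or.inl rfl)
    rw [map_neg, hs, map_sum, map_sum, neg_nonneg] at h1
    have h2 := Finset.sum_nonneg fun x (hx : x ∈ G.filter (· ∈ T)) =>
      hlG x (Finset.mem_filter.1 hx).1
    exact (Finset.sum_eq_zero_iff_of_nonneg fun x (hx : x ∈ G.filter (· ∈ T)) =>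
      hlG x (Finset.mem_filter.1 hx).1).1 (le_antisymm h1 h2) x (Finset.mem_filter.2 ⟨hx, hxT⟩)
  choose l hl0 hlT hlpos using key
  -- In the sum, all terms are nonnegative on `G` and vanish on generators in `T`, while the term
  -- indexed by a generator outside `T` is positive there.
  obtain ⟨L, hL⟩ := exists_real_extension (∑ g ∈ G, l g)
  have hL' : ∀ x, L (latticePoint x) = ((∑ g ∈ G, l g (rationalPoint d x) : ℚ) : ℝ) := fun x => by
    rw [hL, LinearMap.sum_apply]
  refine ⟨L, fun a ha => ?_⟩
  rw [← hG] at ha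
  suffices H : 0 ≤ L (latticePoint a) ∧ (L (latticePoint a) = 0 → a ∈ T) ∧
      (a ∈ T → L (latticePoint a) = 0) from ⟨H.1, H.2.1, H.2.2⟩
  induction ha using AddSubmonoid.closure_induction with
  | mem x hx =>
    have hnn : ∀ g ∈ G, 0 ≤ l g (rationalPoint d x) := fun g _ => hl0 g x hx
    refine ⟨?_, fun h => ?_, fun h => ?_⟩
    · rw [hL']; exact_mod_cast Finset.sum_nonneg hnn
    · rw [hL'] at h
      by_contra hxT
      exact (hlpos x hx hxT).ne' ((Finset.sum_eq_zero_iff_of_nonneg hnn).1 (by exact_mod_cast h) x hx)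
    · rw [hL']; exact_mod_cast Finset.sum_eq_zero fun g _ => hlT g x hx h
  | zero => simp [latticePoint_zero]
  | add x y hx hy h1 h2 =>
    rw [hG] at hx hy
    rw [latticePoint_add, map_add]
    refine ⟨add_nonneg h1.1 h2.1, fun h => ?_, fun h => ?_⟩
    · obtain ⟨h1', h2'⟩ := (add_eq_zero_iff_of_nonneg h1.1 h2.1).1 h
      exact add_mem (h1.2.1 h1') (h2.2.1 h2')
    · rw [h1.2.2 (hT x hx y hy h), h2.2.2 (hT y hy x hx (add_comm x y ▸ h)), add_zero]

end FaceFunctional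

/-! ### Restricted subfans from summand-closed subsets -/

namespace MonoidalComplex

variable {d : ℕ} {F Γ : RationalPointedFan d}

/-- Each cone is generated by its monoid, so inclusions of cones can be tested on lattice points. -/
theorem cone_le_of_monoid_le (M : MonoidalComplex F)
    (C D : {C : PointedCone ℝ (Fin d → ℝ) // C ∈ F.cones})
    (h : M.monoid C ≤ M.monoid D) : C.1 ≤ D.1 := by
  rw [← M.generates C, ← M.generates D]
  exact Submodule.span_mono (Set.image_mono h)

/-- A summand-closed submonoid of `M_C` is `M_D` for a cone `D ⊆ C` of the fan. -/
theorem exists_cone_of_summand_closed (M : MonoidalComplex F)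
    (C : {C : PointedCone ℝ (Fin d → ℝ) // C ∈ F.cones}) {T : AddSubmonoid (Fin d → ℤ)}
    (hTC : T ≤ M.monoid C)
    (hT : ∀ a ∈ M.monoid C, ∀ b ∈ M.monoid C, a + b ∈ T → a ∈ T) :
    ∃ D : {C : PointedCone ℝ (Fin d → ℝ) // C ∈ F.cones}, M.monoid D = T := by
  obtain ⟨L, hL⟩ := exists_linearForm_of_summand_closed (M.fg C) hT
  have hLC : ∀ x ∈ C.1, 0 ≤ L x := by
    intro x hx
    rw [← M.generates C] at hx
    induction hx using Submodule.span_induction with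
    | mem x hx => obtain ⟨a, ha, rfl⟩ := hx; exact (hL a ha).1
    | zero => simp
    | add x y _ _ hx hy => rw [map_add]; exact add_nonneg hx hy
    | smul c x _ hx =>
      change 0 ≤ L ((c : ℝ) • x)
      rw [map_smul]; exact mul_nonneg c.2 hx
  -- The face of `C` on which `L` vanishes.
  let D : PointedCone ℝ (Fin d → ℝ) := C.1 ⊓ PointedCone.ofSubmodule L.ker
  have hD : ∀ x, x ∈ D ↔ x ∈ C.1 ∧ L x = 0 := fun x => Iff.rfl
  refine ⟨⟨D, F.face_mem C.1 C.2 D ⟨L, hLC, hD⟩⟩, ?_⟩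
  ext a
  rw [M.compatible C ⟨D, _⟩ inf_le_left a, hD]
  exact ⟨fun h => (hL a h.1).2.1 h.2.2,
    fun h => ⟨hTC h, M.mem_cone C a (hTC h), (hL a (hTC h)).2.2 h⟩⟩

/-- A set of lattice points that on every `M_C` is a summand-closed submonoid is the support of
the monoidal complex induced on a restricted subfan. -/
theorem exists_restrictedSubfan_of_summand_closed (M : MonoidalComplex F) {S : Set (Fin d → ℤ)}
    (h0 : 0 ∈ S)
    (hS : ∀ C, ∀ a ∈ M.monoid C, ∀ b ∈ M.monoid C, a + b ∈ S ↔ a ∈ S ∧ b ∈ S) :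
    ∃ (Γ : RationalPointedFan d) (h : Γ.IsRestrictedSubfan F),
      ∀ a ∈ M.support, a ∈ (M.restrict h.isSubfan).support ↔ a ∈ S := by
  have key : ∀ C, ∃ D : {C : PointedCone ℝ (Fin d → ℝ) // C ∈ F.cones}, D.1 ≤ C.1 ∧
      ∀ a, a ∈ M.monoid D ↔ a ∈ M.monoid C ∧ a ∈ S := by
    intro C
    obtain ⟨D, hD⟩ := M.exists_cone_of_summand_closed C
      (T := { carrier := {a | a ∈ M.monoid C ∧ a ∈ S}
              zero_mem' := ⟨zero_mem _, h0⟩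
              add_mem' := fun {a b} ha hb =>
                ⟨add_mem ha.1 hb.1, (hS C a ha.1 b hb.1).2 ⟨ha.2, hb.2⟩⟩ })
      (fun a ha => ha.1) (fun a ha b hb hab => ⟨ha, ((hS C a ha b hb).1 hab.2).1⟩)
    have hD' : ∀ a, a ∈ M.monoid D ↔ a ∈ M.monoid C ∧ a ∈ S := fun a => by rw [hD]; rfl
    exact ⟨D, M.cone_le_of_monoid_le D C fun a ha => ((hD' a).1 ha).1, hD'⟩
  -- These are exactly the cones whose monoids lie in `S`; the cone supplied by `key` for `C` is one
  -- of them.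
  let cones : Set (PointedCone ℝ (Fin d → ℝ)) :=
    {C | ∃ h : C ∈ F.cones, ∀ a ∈ M.monoid ⟨C, h⟩, a ∈ S}
  have hsub : cones ⊆ F.cones := fun C hC => hC.1
  have hdown : ∀ C ∈ cones, ∀ D ∈ F.cones, D ≤ C → D ∈ cones := fun C ⟨hC, hCS⟩ D hD hDC =>
    ⟨hD, fun a ha => hCS a ((M.compatible ⟨C, hC⟩ ⟨D, hD⟩ hDC a).1 ha).1⟩
  have hmem : ∀ D : {C : PointedCone ℝ (Fin d → ℝ) // C ∈ F.cones},
      (∀ a ∈ M.monoid D, a ∈ S) → D.1 ∈ cones := fun D hD => ⟨D.2, hD⟩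
  let Γ : RationalPointedFan d :=
    { cones := cones
      nonempty := by
        obtain ⟨C, hC⟩ := F.nonempty
        obtain ⟨D, _, hD⟩ := key ⟨C, hC⟩
        exact ⟨D.1, hmem D fun a ha => ((hD a).1 ha).2⟩
      rational := fun C hC => F.rational C (hsub hC)
      pointed := fun C hC => F.pointed C (hsub hC)
      face_mem := fun C hC C' hC' => hdown C hC C' (F.face_mem C (hsub hC) C' hC') (by
        obtain ⟨l, _, h⟩ := hC'
        exact fun x hx => ((h x).1 hx).1)
      inter_face := fun C hC D hD => F.inter_face C (hsub hC) D (hsub hD) }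
  have hΓ : Γ.IsRestrictedSubfan F := by
    refine ⟨hsub, ?_⟩
    rintro s hs ⟨C, hC, hsC⟩
    obtain ⟨D, _, hD⟩ := key ⟨C, hC⟩
    refine ⟨D.1, hmem D fun a ha => ((hD a).1 ha).2, fun x hx => ?_⟩
    obtain ⟨E, hE, hxE⟩ := hs x hx
    -- The monoid of `C ⊓ E` lies in `M_C` and in `S`, hence in `M_D`. So `D`, which depends only on
    -- `C`, contains all the given points.
    have hCE : C ⊓ E ∈ F.cones := F.face_mem C hC _ (F.inter_face C hC E (hsub hE)).1
    refine M.cone_le_of_monoid_le ⟨C ⊓ E, hCE⟩ D (fun a ha => ?_) ⟨hsC x hx, hxE⟩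
    exact (hD a).2 ⟨((M.compatible ⟨C, hC⟩ ⟨C ⊓ E, hCE⟩ inf_le_left a).1 ha).1,
      (hdown E hE _ hCE inf_le_right).2 a ha⟩
  refine ⟨Γ, hΓ, fun a ⟨C, ha⟩ => ⟨fun ⟨D, hD⟩ => D.2.2 a hD, fun haS => ?_⟩⟩
  obtain ⟨D, _, hD⟩ := key C
  exact ⟨⟨D.1, hmem D fun a ha => ((hD a).1 ha).2⟩, (hD a).2 ⟨ha, haS⟩⟩

end MonoidalComplex

/-! ### Inclusions and projections of toric face rings -/

namespace MonoidalComplex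

variable {d : ℕ} {F Γ : RationalPointedFan d}

theorem support_restrict_subset (M : MonoidalComplex F) (h : Γ.IsSubfan F) :
    (M.restrict h).support ⊆ M.support := fun _ ⟨C, ha⟩ => ⟨⟨C.1, h C.2⟩, ha⟩

theorem Compat.mem_support {M : MonoidalComplex F} {a b : Fin d → ℤ} (h : M.Compat a b) :
    a ∈ M.support :=
  let ⟨C, ha, _⟩ := h
  ⟨C, ha⟩

theorem Compat.of_restrict {M : MonoidalComplex F} {h : Γ.IsSubfan F} {a b : Fin d → ℤ}
    (hab : (M.restrict h).Compat a b) : M.Compat a b :=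
  let ⟨C, hC⟩ := hab
  ⟨⟨C.1, h C.2⟩, hC⟩

/-- Two cones meet in a face, and a face contains the summands of its elements. So the projection
cannot lose a factor of a product that survives. -/
theorem Compat.restrict_of_add_mem {M : MonoidalComplex F} {h : Γ.IsSubfan F} {a b : Fin d → ℤ}
    (hab : M.Compat a b) (hadd : a + b ∈ (M.restrict h).support) :
    (M.restrict h).Compat a b := by
  obtain ⟨C, ha, hb⟩ := hab
  obtain ⟨D, hD⟩ := hadd
  exact ⟨D, M.mem_of_add_mem (D := ⟨D.1, h D.2⟩) ha hb (M.mem_cone ⟨D.1, h D.2⟩ _ hD)⟩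

/-- Restrictedness is applied to just two lattice points. It ensures that a product vanishing in
`k[M_Γ]` also vanishes in `k[M]`. -/
theorem Compat.restrict {M : MonoidalComplex F} (h : Γ.IsRestrictedSubfan F) {a b : Fin d → ℤ}
    (hab : M.Compat a b) (ha : a ∈ (M.restrict h.isSubfan).support)
    (hb : b ∈ (M.restrict h.isSubfan).support) : (M.restrict h.isSubfan).Compat a b := by
  classical
  obtain ⟨C, haC, hbC⟩ := hab
  obtain ⟨A, hA⟩ := ha
  obtain ⟨B, hB⟩ := hb
  obtain ⟨D, hD, hDab⟩ := h.exists_cone {latticePoint a, latticePoint b}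
    (by
      simp only [Finset.mem_insert, Finset.mem_singleton]
      rintro x (rfl | rfl)
      · exact ⟨A.1, A.2, (M.restrict h.isSubfan).mem_cone A a hA⟩
      · exact ⟨B.1, B.2, (M.restrict h.isSubfan).mem_cone B b hB⟩)
    ⟨C.1, C.2, by
      simp only [Finset.mem_insert, Finset.mem_singleton]
      rintro x (rfl | rfl)
      · exact M.mem_cone C a haC
      · exact M.mem_cone C b hbC⟩
  exact ⟨⟨D, hD⟩, M.mem_monoid_of_mem_cone (D := ⟨D, h.isSubfan hD⟩) haC (hDab _ (by simp)),
    M.mem_monoid_of_mem_cone (D := ⟨D, h.isSubfan hD⟩) hbC (hDab _ (by simp))⟩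

end MonoidalComplex

namespace ToricFaceRing

variable {k : Type*} [Field k] {d : ℕ} {F Γ : RationalPointedFan d} {M : MonoidalComplex F}

theorem basis_mul_basis_of_compat {a b : M.support} (h : M.Compat a.1 b.1) :
    basis k M a * basis k M b = basis k M ⟨a.1 + b.1, h.add_mem⟩ := by
  rw [basis_mul_basis, basisMul, dif_pos h]

theorem basis_mul_basis_of_not_compat {a b : M.support} (h : ¬ M.Compat a.1 b.1) :
    basis k M a * basis k M b = 0 := by
  rw [basis_mul_basis, basisMul, dif_neg h]

/-- A linear map on `k[M]` that preserves `1` and the products of basis elements is an algebra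
homomorphism. -/
noncomputable def algHomOfBasis {R : Type*} [CommRing R] [Algebra k R]
    (f : ToricFaceRing k M →ₗ[k] R) (h1 : f 1 = 1)
    (hmul : ∀ a b, f (basis k M a * basis k M b) = f (basis k M a) * f (basis k M b)) :
    ToricFaceRing k M →ₐ[k] R :=
  AlgHom.ofLinearMap f h1 fun x y =>
    LinearMap.congr_fun₂ (f := (mulLin k M).compr₂ f)
      (g := (LinearMap.mul k R).compl₁₂ f f)
      ((basis k M).ext fun a => (basis k M).ext fun b => hmul a b) x y

/-- A linear map between toric face rings that maps `t^a` into degree `a` is graded. -/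
theorem map_mem_grading {M' : MonoidalComplex Γ} (f : ToricFaceRing k M →ₗ[k] ToricFaceRing k M')
    (hf : ∀ a, f (basis k M a) ∈ grading k M' a.1) {n : Fin d → ℤ} {x : ToricFaceRing k M}
    (hx : x ∈ grading k M n) : f x ∈ grading k M' n := by
  refine (Submodule.span_le (p := (grading k M' n).comap f)).2 ?_ hx
  rintro _ ⟨a, rfl, rfl⟩
  exact hf a

/-- The linear inclusion `k[M_Γ] → k[M]`. -/
noncomputable def inclLin (k : Type*) [Field k] (M : MonoidalComplex F) (h : Γ.IsSubfan F) :
    ToricFaceRing k (M.restrict h) →ₗ[k] ToricFaceRing k M :=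
  (basis k (M.restrict h)).constr k fun a => basis k M ⟨a.1, M.support_restrict_subset h a.2⟩

open Classical in
/-- The linear projection `k[M] → k[M_Γ]`. -/
noncomputable def projLin (k : Type*) [Field k] (M : MonoidalComplex F) (h : Γ.IsSubfan F) :
    ToricFaceRing k M →ₗ[k] ToricFaceRing k (M.restrict h) :=
  (basis k M).constr k fun a =>
    if ha : a.1 ∈ (M.restrict h).support then basis k (M.restrict h) ⟨a.1, ha⟩ else 0

theorem inclLin_basis (h : Γ.IsSubfan F) (a : (M.restrict h).support) :
    inclLin k M h (basis k _ a) = basis k M ⟨a.1, M.support_restrict_subset h a.2⟩ := by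
  rw [inclLin, Module.Basis.constr_basis]

theorem projLin_basis_of_mem (h : Γ.IsSubfan F) {a : M.support}
    (ha : a.1 ∈ (M.restrict h).support) :
    projLin k M h (basis k _ a) = basis k (M.restrict h) ⟨a.1, ha⟩ := by
  rw [projLin, Module.Basis.constr_basis, dif_pos ha]

theorem projLin_basis_of_notMem (h : Γ.IsSubfan F) {a : M.support}
    (ha : a.1 ∉ (M.restrict h).support) : projLin k M h (basis k _ a) = 0 := by
  rw [projLin, Module.Basis.constr_basis, dif_neg ha]

/-- For a restricted subfan `Γ` the inclusion `k[M_Γ] → k[M]` is an algebra homomorphism. -/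
noncomputable def incl (k : Type*) [Field k] (M : MonoidalComplex F)
    (h : Γ.IsRestrictedSubfan F) :
    ToricFaceRing k (M.restrict h.isSubfan) →ₐ[k] ToricFaceRing k M :=
  algHomOfBasis (inclLin k M h.isSubfan) (by rw [one_def, inclLin_basis]; rfl) fun a b => by
    rw [inclLin_basis, inclLin_basis]
    by_cases hab : (M.restrict h.isSubfan).Compat a.1 b.1
    · rw [basis_mul_basis_of_compat hab, inclLin_basis,
        basis_mul_basis_of_compat (M := M) hab.of_restrict]
    · rw [basis_mul_basis_of_not_compat hab, map_zero,
        basis_mul_basis_of_not_compat fun hc => hab (hc.restrict h a.2 b.2)]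

/-- The projection `k[M] → k[M_Γ]` onto the toric face ring of a subfan. -/
noncomputable def proj (k : Type*) [Field k] (M : MonoidalComplex F)
    (h : Γ.IsRestrictedSubfan F) :
    ToricFaceRing k M →ₐ[k] ToricFaceRing k (M.restrict h.isSubfan) :=
  algHomOfBasis (projLin k M h.isSubfan)
    (by rw [one_def, projLin_basis_of_mem h.isSubfan (M.restrict h.isSubfan).zero_mem_support]
        rfl) fun a b => by
    by_cases hab : M.Compat a.1 b.1
    · rw [basis_mul_basis_of_compat hab]
      by_cases hs : a.1 + b.1 ∈ (M.restrict h.isSubfan).support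
      · have hc := hab.restrict_of_add_mem hs
        rw [projLin_basis_of_mem h.isSubfan hs, projLin_basis_of_mem h.isSubfan hc.mem_support,
          projLin_basis_of_mem h.isSubfan hc.symm.mem_support, basis_mul_basis_of_compat hc]
      · rw [projLin_basis_of_notMem h.isSubfan hs]
        by_cases ha : a.1 ∈ (M.restrict h.isSubfan).support
        · by_cases hb : b.1 ∈ (M.restrict h.isSubfan).support
          · exact (hs (hab.restrict h ha hb).add_mem).elim
          · rw [projLin_basis_of_notMem h.isSubfan hb, mul_zero]
        · rw [projLin_basis_of_notMem h.isSubfan ha, zero_mul]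
    · rw [basis_mul_basis_of_not_compat hab, map_zero]
      by_cases ha : a.1 ∈ (M.restrict h.isSubfan).support
      · by_cases hb : b.1 ∈ (M.restrict h.isSubfan).support
        · rw [projLin_basis_of_mem h.isSubfan ha, projLin_basis_of_mem h.isSubfan hb,
            basis_mul_basis_of_not_compat (a := ⟨a.1, ha⟩) (b := ⟨b.1, hb⟩) fun hc =>
              hab hc.of_restrict]
        · rw [projLin_basis_of_notMem h.isSubfan hb, mul_zero]
      · rw [projLin_basis_of_notMem h.isSubfan ha, zero_mul]

section

variable (h : Γ.IsRestrictedSubfan F)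

theorem incl_basis (a : (M.restrict h.isSubfan).support) :
    incl k M h (basis k _ a) = basis k M ⟨a.1, M.support_restrict_subset h.isSubfan a.2⟩ :=
  inclLin_basis _ a

theorem proj_basis_of_mem {a : M.support} (ha : a.1 ∈ (M.restrict h.isSubfan).support) :
    proj k M h (basis k _ a) = basis k (M.restrict h.isSubfan) ⟨a.1, ha⟩ :=
  projLin_basis_of_mem _ ha

theorem proj_basis_of_notMem {a : M.support} (ha : a.1 ∉ (M.restrict h.isSubfan).support) :
    proj k M h (basis k _ a) = 0 :=
  projLin_basis_of_notMem _ ha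

theorem proj_incl (x : ToricFaceRing k (M.restrict h.isSubfan)) :
    proj k M h (incl k M h x) = x := by
  refine LinearMap.congr_fun (f := (proj k M h).toLinearMap ∘ₗ (incl k M h).toLinearMap)
    (g := LinearMap.id) ((basis k _).ext fun a => ?_) x
  simp [incl_basis, proj_basis_of_mem h (a := ⟨a.1, M.support_restrict_subset h.isSubfan a.2⟩) a.2]

theorem incl_mem_grading {n : Fin d → ℤ} {x : ToricFaceRing k (M.restrict h.isSubfan)}
    (hx : x ∈ grading k (M.restrict h.isSubfan) n) : incl k M h x ∈ grading k M n :=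
  map_mem_grading (incl k M h).toLinearMap (fun a => by
    rw [AlgHom.toLinearMap_apply, incl_basis]
    exact basis_mem_grading (k := k) (M := M) ⟨a.1, _⟩) hx

theorem proj_mem_grading {n : Fin d → ℤ} {x : ToricFaceRing k M} (hx : x ∈ grading k M n) :
    proj k M h x ∈ grading k (M.restrict h.isSubfan) n :=
  map_mem_grading (proj k M h).toLinearMap (fun a => by
    rw [AlgHom.toLinearMap_apply]
    by_cases ha : a.1 ∈ (M.restrict h.isSubfan).support
    · rw [proj_basis_of_mem h ha]
      exact basis_mem_grading (k := k) (M := M.restrict h.isSubfan) ⟨a.1, ha⟩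
    · rw [proj_basis_of_notMem h ha]; exact zero_mem _) hx

end

/-! ### Idempotent graded endomorphisms -/

instance : Nontrivial (ToricFaceRing k M) :=
  ⟨⟨1, 0, (basis k M).ne_zero _⟩⟩

/-- Distinct basis elements have distinct degrees. Hence graded endomorphisms act diagonally on the
basis. -/
theorem exists_smul_basis_of_mem_grading {a : M.support} {x : ToricFaceRing k M}
    (hx : x ∈ grading k M a.1) : ∃ c : k, x = c • basis k M a := by
  have h : {x | ∃ b : M.support, b.1 = a.1 ∧ x = basis k M b} = {basis k M a} := by
    ext x
    constructor
    · rintro ⟨b, hb, rfl⟩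
      rw [Subtype.ext hb]; rfl
    · rintro rfl
      exact ⟨a, rfl, rfl⟩
  rw [grading, h] at hx
  obtain ⟨c, rfl⟩ := Submodule.mem_span_singleton.1 hx
  exact ⟨c, rfl⟩

/-- An idempotent graded endomorphism of the `k`-algebra `k[M]` is the composition of the
projection to and the inclusion of `k[M_Γ]` for a restricted subfan `Γ`. -/
theorem exists_restrictedSubfan_of_idempotent (ε : ToricFaceRing k M →ₐ[k] ToricFaceRing k M)
    (hidem : ∀ x, ε (ε x) = ε x) (hgr : ∀ n, ∀ x ∈ grading k M n, ε x ∈ grading k M n) :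
    ∃ (Γ : RationalPointedFan d) (h : Γ.IsRestrictedSubfan F),
      ∀ x, incl k M h (proj k M h x) = ε x := by
  have hε : ∀ a, ε (basis k M a) ≠ 0 → ε (basis k M a) = basis k M a := by
    intro a ha
    obtain ⟨c, hc⟩ := exists_smul_basis_of_mem_grading (hgr a.1 _ (basis_mem_grading a))
    have h2 := hidem (basis k M a)
    rw [hc, map_smul] at h2
    have hc0 : c ≠ 0 := by rintro rfl; exact ha (by rw [hc, zero_smul])
    -- Idempotency reads `c • ε (t^a) = c • t^a`, and `c` cancels.
    exact smul_right_injective _ hc0 h2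
  let S : Set (Fin d → ℤ) := {a | ∃ h : a ∈ M.support, ε (basis k M ⟨a, h⟩) ≠ 0}
  have hS0 : 0 ∈ S := ⟨M.zero_mem_support, by rw [← one_def, map_one]; exact one_ne_zero⟩
  have hS : ∀ C, ∀ a ∈ M.monoid C, ∀ b ∈ M.monoid C, a + b ∈ S ↔ a ∈ S ∧ b ∈ S := by
    intro C a ha b hb
    have hab : M.Compat a b := ⟨C, ha, hb⟩
    have hmul := congrArg ε (basis_mul_basis_of_compat (k := k) (M := M)
      (a := ⟨a, C, ha⟩) (b := ⟨b, C, hb⟩) hab)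
    rw [map_mul] at hmul
    constructor
    · rintro ⟨_, hne⟩
      rw [← hmul] at hne
      exact ⟨⟨⟨C, ha⟩, left_ne_zero_of_mul hne⟩, ⟨⟨C, hb⟩, right_ne_zero_of_mul hne⟩⟩
    · rintro ⟨⟨ha', hna⟩, ⟨hb', hnb⟩⟩
      refine ⟨hab.add_mem, ?_⟩
      -- Two nonzero factors do not suffice, as `k[M]` may have zero divisors; they must be `t^a`
      -- and `t^b` themselves.
      rw [← hmul, hε _ hna, hε _ hnb, basis_mul_basis_of_compat hab]
      exact (basis k M).ne_zero _
  obtain ⟨Γ, h, hΓ⟩ := M.exists_restrictedSubfan_of_summand_closed hS0 hS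
  refine ⟨Γ, h, LinearMap.congr_fun
    (f := (incl k M h).toLinearMap ∘ₗ (proj k M h).toLinearMap) (g := ε.toLinearMap)
    ((basis k M).ext fun a => ?_)⟩
  simp only [LinearMap.comp_apply, AlgHom.toLinearMap_apply]
  by_cases ha : a.1 ∈ (M.restrict h.isSubfan).support
  · obtain ⟨_, hne⟩ := (hΓ a.1 a.2).1 ha
    rw [proj_basis_of_mem h ha, incl_basis, hε _ hne]
  · rw [proj_basis_of_notMem h ha, map_zero]
    by_contra hne
    exact ha ((hΓ a.1 a.2).2 ⟨a.2, fun h0 => hne h0.symm⟩)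

theorem mem_grading_zero_iff {x : ToricFaceRing k M} :
    x ∈ grading k M 0 ↔ ∃ c : k, algebraMap k _ c = x := by
  constructor
  · intro hx
    obtain ⟨c, rfl⟩ := exists_smul_basis_of_mem_grading (a := ⟨0, M.zero_mem_support⟩) hx
    exact ⟨c, Algebra.algebraMap_eq_smul_one c⟩
  · rintro ⟨c, rfl⟩
    exact SetLike.algebraMap_mem_graded (grading k M) c

/-- Idempotent graded ring endomorphisms of `k[M]` are `k`-linear. -/
theorem idempotent_commutes (ε : ToricFaceRing k M →+* ToricFaceRing k M)
    (hidem : ∀ x, ε (ε x) = ε x) (hgr : ∀ n, ∀ x ∈ grading k M n, ε x ∈ grading k M n) (c : k) :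
    ε (algebraMap k _ c) = algebraMap k _ c := by
  obtain ⟨c', hc'⟩ := mem_grading_zero_iff.1 (hgr 0 _ (mem_grading_zero_iff.2 ⟨c, rfl⟩))
  -- With `ε c = c'` in `k`, idempotency gives `ε c' = ε c`, and ring homomorphisms out of a field
  -- into a nontrivial ring are injective.
  have h : (ε.comp (algebraMap k _)) c' = (ε.comp (algebraMap k _)) c := by
    rw [RingHom.comp_apply, hc', hidem]; rfl
  rw [← hc', (ε.comp (algebraMap k _)).injective h]

end ToricFaceRing

/-! ### Graded retracts of toric face rings -/

section Retracts

open ToricFaceRing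

variable {d : ℕ} {F Γ : RationalPointedFan d} {M : MonoidalComplex F} {k : Type*} [Field k]
  {A : Type*} [CommRing A]

/-- The idempotents `θ ∘ φ` and `incl ∘ proj` coincide, so `proj ∘ θ` and `φ ∘ incl` are mutually
inverse. -/
theorem isGradedRetract_iff (𝒜 : (Fin d → ℤ) → AddSubgroup A) :
    IsGradedRetract 𝒜 (grading k M) ↔ ∃ (Γ : RationalPointedFan d) (h : Γ.IsRestrictedSubfan F),
      IsGradedIso 𝒜 (grading k (M.restrict h.isSubfan)) := by
  constructor
  · rintro ⟨θ, φ, hφθ⟩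
    have hidem : ∀ x, (θ.toRingHom.comp φ.toRingHom) ((θ.toRingHom.comp φ.toRingHom) x) =
        (θ.toRingHom.comp φ.toRingHom) x := fun x => congrArg θ (hφθ (φ x))
    have hgr : ∀ n, ∀ x ∈ grading k M n, (θ.toRingHom.comp φ.toRingHom) x ∈ grading k M n :=
      fun n x hx => θ.map_mem (φ.map_mem hx)
    obtain ⟨Γ, h, hε⟩ := exists_restrictedSubfan_of_idempotent
      { θ.toRingHom.comp φ.toRingHom with commutes' := idempotent_commutes _ hidem hgr } hidem hgr
    replace hε : ∀ x, incl k M h (proj k M h x) = θ (φ x) := hε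
    have h1 : ∀ x, φ (incl k M h (proj k M h (θ x))) = x := fun x => by rw [hε, hφθ, hφθ]
    have h2 : ∀ y, proj k M h (θ (φ (incl k M h y))) = y := fun y => by
      rw [← hε, proj_incl, proj_incl]
    refine ⟨Γ, h, RingEquiv.ofRingHom ((proj k M h : _ →+* _).comp θ.toRingHom)
      (φ.toRingHom.comp (incl k M h : _ →+* _)) (RingHom.ext h2) (RingHom.ext h1), fun n x => ?_⟩
    refine ⟨fun hx => ?_, fun hx => proj_mem_grading h (θ.map_mem hx)⟩
    -- Degrees are reflected because the inverse map is graded too.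
    rw [← h1 x]
    exact φ.map_mem (incl_mem_grading h hx)
  · rintro ⟨Γ, h, e, he⟩
    refine ⟨⟨(incl k M h : _ →+* _).comp e.toRingHom,
        fun hx => incl_mem_grading h ((he _ _).2 hx)⟩,
      ⟨e.symm.toRingHom.comp (proj k M h : _ →+* _), fun {n x} hx => (he _ _).1 ?_⟩, fun x => ?_⟩
    · change e (e.symm (proj k M h x)) ∈ _
      rw [e.apply_symm_apply]
      exact proj_mem_grading h hx
    · change e.symm (proj k M h (incl k M h (e x))) = x
      rw [proj_incl, e.symm_apply_apply]

theorem isGradedRetractOver_iff [Algebra k A] (𝒜 : (Fin d → ℤ) → Submodule k A)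
    [GradedAlgebra 𝒜] :
    IsGradedRetractOver k 𝒜 (grading k M) ↔
      ∃ (Γ : RationalPointedFan d) (h : Γ.IsRestrictedSubfan F),
        IsGradedIsoOver k 𝒜 (grading k (M.restrict h.isSubfan)) := by
  constructor
  · rintro ⟨θ, φ, hφθ⟩
    obtain ⟨Γ, h, hε⟩ := exists_restrictedSubfan_of_idempotent (θ.toAlgHom.comp φ.toAlgHom)
      (fun x => congrArg θ (hφθ (φ x))) (fun n x hx => θ.map_mem (φ.map_mem hx))
    replace hε : ∀ x, incl k M h (proj k M h x) = θ (φ x) := hε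
    have h1 : ∀ x, φ (incl k M h (proj k M h (θ x))) = x := fun x => by rw [hε, hφθ, hφθ]
    have h2 : ∀ y, proj k M h (θ (φ (incl k M h y))) = y := fun y => by
      rw [← hε, proj_incl, proj_incl]
    refine ⟨Γ, h, AlgEquiv.ofAlgHom ((proj k M h).comp θ.toAlgHom)
      (φ.toAlgHom.comp (incl k M h)) (AlgHom.ext h2) (AlgHom.ext h1), fun n x => ?_⟩
    refine ⟨fun hx => ?_, fun hx => proj_mem_grading h (θ.map_mem hx)⟩
    rw [← h1 x]
    exact φ.map_mem (incl_mem_grading h hx)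
  · rintro ⟨Γ, h, e, he⟩
    refine ⟨{ (incl k M h).comp e.toAlgHom with
        map_mem := fun hx => incl_mem_grading h ((he _ _).2 hx) },
      { e.symm.toAlgHom.comp (proj k M h) with
        map_mem := fun {n x} hx => (he _ _).1 ?_ }, fun x => ?_⟩
    · change e (e.symm (proj k M h x)) ∈ _
      rw [e.apply_symm_apply]
      exact proj_mem_grading h hx
    · change e.symm (proj k M h (incl k M h (e x))) = x
      rw [proj_incl, e.symm_apply_apply]

end Retracts

theorem proposition4p5 {d : ℕ} (F : RationalPointedFan d) (M : MonoidalComplex F)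
    (k : Type*) [Field k] (A : Type*) [CommRing A] :
    (∀ (𝒜 : (Fin d → ℤ) → AddSubgroup A) [GradedRing 𝒜],
      IsGradedRetract 𝒜 (ToricFaceRing.grading k M) ↔
        ∃ (Γ : RationalPointedFan d) (h : Γ.IsRestrictedSubfan F),
          IsGradedIso 𝒜 (ToricFaceRing.grading k (M.restrict h.isSubfan))) ∧
    (∀ [Algebra k A] (𝒜 : (Fin d → ℤ) → Submodule k A) [GradedAlgebra 𝒜],
      IsGradedRetractOver k 𝒜 (ToricFaceRing.grading k M) ↔
        ∃ (Γ : RationalPointedFan d) (h : Γ.IsRestrictedSubfan F),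
          IsGradedIsoOver k 𝒜 (ToricFaceRing.grading k (M.restrict h.isSubfan))) := by
  exact ⟨fun 𝒜 _ => isGradedRetract_iff 𝒜, fun 𝒜 _ => isGradedRetractOver_iff 𝒜⟩
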